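/- There is an absolute constant $k_0$ such that the following holds for all integers $k \ge k_0$ and $n$. Let $G$ be a primitive permutation group of degree $n$ (a transitive subgroup of the symmetric group of a finite set of $n$ elements, preserving no nontrivial system of blocks), let $\varphi : G \to \mathrm{Alt}(k)$ be an epimorphism (a surjective group homomorphism) onto the alternating group of degree $k$, and assume that $k > (\log_2 n)^5$. Then $\varphi$ is an isomorphism; hence $G \cong \mathrm{Alt}(k)$. -/

import Mathlib

/-! If `φ` is not injective, primitivity makes its kernel transitive. Then every element outside the
kernel moves at least `n / 3` points: a commutator of two elements moves few points when their
supports meet in few, and conjugation by the kernel makes supports meet in few points without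
changing images. If a prime `p` divides the order of `φ g`, some power of `g` outside the kernel
moves only points on `g`-cycles of length divisible by `p`, so these cycles cover a third of the
points. A cycle length has at most `log₂ n` prime divisors, so at most `3 log₂ n` primes occur. But
`Alt(k)` with `k > (log₂ n) ^ 5` has an element whose order has more prime divisors. -/

theorem MulAction.card_mul_card_smul_eq {H Ω : Type*} [Group H] [MulAction H Ω] [Fintype H]
    [Fintype Ω] [DecidableEq Ω] [MulAction.IsPretransitive H Ω] (a b : Ω) :
    Fintype.card Ω * (Finset.univ.filter fun h : H => h • b = a).card = Fintype.card H := by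
  have key : ∀ c : Ω, (Finset.univ.filter fun h : H => h • b = c).card =
      (Finset.univ.filter fun h : H => h • b = a).card := by
    intro c
    obtain ⟨g, rfl⟩ := MulAction.exists_smul_eq H c a
    refine Finset.card_bij' (fun h _ => g * h) (fun h _ => g⁻¹ * h) ?_ ?_ ?_ ?_ <;>
      simp +contextual [mul_smul]
  have h := Finset.card_eq_sum_card_fiberwise (s := (Finset.univ : Finset H))
    (t := (Finset.univ : Finset Ω)) (f := fun h => h • b) (by simp)
  simp only [key, Finset.sum_const, Finset.card_univ, smul_eq_mul] at h
  exact h.symm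

/-- Averaging over `H`: by transitivity each pair `(a, b)` is matched by `|H| / |Ω|` elements. -/
theorem MulAction.exists_card_mul_card_filter_smul_mem_le {H Ω : Type*} [Group H] [MulAction H Ω]
    [Fintype H] [Fintype Ω] [DecidableEq Ω] [MulAction.IsPretransitive H Ω] (A B : Finset Ω) :
    ∃ h : H, Fintype.card Ω * (B.filter fun b => h • b ∈ A).card ≤ A.card * B.card := by
  by_contra! hlt
  have h1 : ∑ h : H, Fintype.card Ω * (B.filter fun b => h • b ∈ A).card =
      ∑ _h : H, A.card * B.card := by
    have h2 : ∀ h : H, (B.filter fun b => h • b ∈ A).card =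
        ∑ b ∈ B, ∑ a ∈ A, if h • b = a then 1 else 0 := by
      intro h
      rw [Finset.card_filter]
      simp
    simp only [h2, ← Finset.mul_sum]
    rw [Finset.sum_comm, Finset.sum_congr rfl fun b _ => Finset.sum_comm]
    simp only [← Finset.card_filter, Finset.mul_sum, card_mul_card_smul_eq, Finset.sum_const,
      Finset.card_univ, smul_eq_mul]
    ring
  exact absurd h1 (Finset.sum_lt_sum_of_nonempty Finset.univ_nonempty fun h _ => hlt h).ne'

theorem MulAction.compl_fixedBy_commutator_subset {G Ω : Type*} [Group G] [MulAction G Ω]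
    (a b : G) : (MulAction.fixedBy Ω (a * b * a⁻¹ * b⁻¹))ᶜ ⊆
      ((MulAction.fixedBy Ω a)ᶜ ∩ (MulAction.fixedBy Ω b)ᶜ) ∪
      ((fun x => a • x) '' ((MulAction.fixedBy Ω a)ᶜ ∩ (MulAction.fixedBy Ω b)ᶜ) ∪
      (fun x => b • x) '' ((MulAction.fixedBy Ω a)ᶜ ∩ (MulAction.fixedBy Ω b)ᶜ)) := by
  intro x hx
  by_contra hI
  apply hx
  have hinv : ∀ (g : G) (y : Ω), g • y = y ↔ g⁻¹ • y = y := fun g y => by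
    rw [inv_smul_eq_iff, eq_comm]
  simp only [Set.mem_union, not_or, Set.mem_inter_iff, Set.mem_compl_iff, MulAction.mem_fixedBy,
    Set.mem_image, not_exists, not_and, not_not] at hI ⊢
  obtain ⟨h0, ha, hb⟩ := hI
  have ha' : a • x ≠ x → b • a⁻¹ • x = a⁻¹ • x := fun h => by
    by_contra hc
    refine ha (a⁻¹ • x) ⟨fun h' => h ?_, hc⟩ (by simp)
    rw [smul_inv_smul] at h'
    rw [hinv, ← h']
  have hb' : b • x ≠ x → a • b⁻¹ • x = b⁻¹ • x := fun h => by
    by_contra hc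
    refine hb (b⁻¹ • x) ⟨hc, fun h' => h ?_⟩ (by simp)
    rw [smul_inv_smul] at h'
    rw [hinv, ← h']
  simp only [mul_smul]
  by_cases hax : a • x = x
  · by_cases hbx : b • x = x
    · rw [(hinv b x).1 hbx, (hinv a x).1 hax, hbx, hax]
    · rw [(hinv a _).1 (hb' hbx), smul_inv_smul, hax]
  · rw [(hinv b x).1 (h0 hax), ha' hax, smul_inv_smul]

/-- Otherwise the centralizer of `y` contains its normal closure, which is all of `S`. -/
theorem IsSimpleGroup.exists_not_commute_conj {S : Type*} [Group S] [IsSimpleGroup S]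
    (hS : Subgroup.center S = ⊥) {y : S} (hy : y ≠ 1) : ∃ x : S, ¬ Commute y (x * y * x⁻¹) := by
  by_contra! h
  have h1 : Subgroup.normalClosure {y} = ⊤ :=
    Subgroup.normalClosure_normal.eq_bot_or_eq_top.resolve_left fun h =>
      hy (Subgroup.mem_bot.1 (h ▸ Subgroup.subset_normalClosure rfl))
  have h2 : Subgroup.normalClosure {y} ≤ Subgroup.centralizer {y} := by
    refine (Subgroup.closure_le _).2 fun z hz => ?_
    obtain ⟨w, rfl, hw⟩ := Group.mem_conjugatesOfSet_iff.1 hz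
    obtain ⟨c, rfl⟩ := isConj_iff.1 hw
    exact Subgroup.mem_centralizer_singleton_iff.2 (h c).symm
  have h3 : y ∈ Subgroup.center S := Subgroup.mem_center_iff.2 fun g =>
    Subgroup.mem_centralizer_singleton_iff.1 (h2 (h1 ▸ Subgroup.mem_top g))
  exact hy (by simpa [hS] using h3)

/-- If the kernel of an epimorphism of a permutation group onto a centerless simple group is
transitive, then every element outside the kernel moves at least a third of the points. -/
theorem MulAction.card_le_three_mul_card_moved_of_map_ne_one {G S Ω : Type*} [Group G] [Finite G]
    [MulAction G Ω] [Finite Ω] [Group S] [IsSimpleGroup S] (hS : Subgroup.center S = ⊥)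
    (φ : G →* S) (hφ : Function.Surjective φ) [MulAction.IsPretransitive φ.ker Ω]
    [FaithfulSMul G Ω] {g : G} (hg : φ g ≠ 1) :
    Nat.card Ω ≤ 3 * (MulAction.fixedBy Ω g)ᶜ.ncard := by
  classical
  have := Fintype.ofFinite G
  have := Fintype.ofFinite Ω
  obtain ⟨a, ha, hmin⟩ := Set.exists_min_image {g : G | φ g ≠ 1}
    (fun g => (MulAction.fixedBy Ω g)ᶜ.ncard) (Set.toFinite _) ⟨g, hg⟩
  refine le_trans ?_ (Nat.mul_le_mul_left 3 (hmin g hg))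
  obtain ⟨y, hy⟩ := IsSimpleGroup.exists_not_commute_conj hS ha
  obtain ⟨x, rfl⟩ := hφ y
  set b := x * a * x⁻¹ with hb
  have hbcard : (MulAction.fixedBy Ω b)ᶜ.ncard = (MulAction.fixedBy Ω a)ᶜ.ncard := by
    have : (MulAction.fixedBy Ω b)ᶜ = (fun y => x • y) '' (MulAction.fixedBy Ω a)ᶜ := by
      ext y
      simp only [hb, Set.mem_compl_iff, MulAction.mem_fixedBy, mul_smul, Set.mem_image]
      constructor
      · intro h
        exact ⟨x⁻¹ • y, by rwa [eq_inv_smul_iff], by simp⟩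
      · rintro ⟨z, hz, rfl⟩
        simpa using hz
    rw [this, Set.ncard_image_of_injective _ (MulAction.injective x)]
  obtain ⟨h, hh⟩ := MulAction.exists_card_mul_card_filter_smul_mem_le (H := φ.ker)
    (MulAction.fixedBy Ω a)ᶜ.toFinset (MulAction.fixedBy Ω b)ᶜ.toFinset
  -- As `φ d = φ b` does not commute with `φ a`, the commutator of `a` and `d` is outside the
  -- kernel, so minimality of `a` applies to it.
  set d := (h : G) * b * (h : G)⁻¹ with hd
  have hφd : φ d = φ b := by
    have : φ h = 1 := h.2
    simp [hd, this]
  have hI : ((MulAction.fixedBy Ω a)ᶜ ∩ (MulAction.fixedBy Ω d)ᶜ).ncard =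
      ((MulAction.fixedBy Ω b)ᶜ.toFinset.filter
        fun z => h • z ∈ (MulAction.fixedBy Ω a)ᶜ.toFinset).card := by
    rw [← Finset.card_image_of_injective _ (MulAction.injective h), ← Set.ncard_coe_finset]
    congr 1
    ext y
    simp only [hd, Set.mem_inter_iff, Set.mem_compl_iff, MulAction.mem_fixedBy, mul_smul,
      Finset.coe_image, Finset.coe_filter, Set.mem_toFinset, Set.mem_image, Set.mem_ofPred_eq,
      Subgroup.smul_def]
    constructor
    · rintro ⟨h1, h2⟩
      exact ⟨(h : G)⁻¹ • y, ⟨by rwa [eq_inv_smul_iff], by simpa using h1⟩, by simp⟩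
    · rintro ⟨z, ⟨h1, h2⟩, rfl⟩
      exact ⟨h2, by simpa using h1⟩
  have hc : φ (a * d * a⁻¹ * d⁻¹) ≠ 1 := by
    intro h1
    simp only [map_mul, map_inv, hφd, mul_inv_eq_iff_eq_mul] at h1
    exact hy (by simpa [hb, Commute, SemiconjBy] using h1)
  have hcI : (MulAction.fixedBy Ω (a * d * a⁻¹ * d⁻¹))ᶜ.ncard ≤
      3 * ((MulAction.fixedBy Ω a)ᶜ ∩ (MulAction.fixedBy Ω d)ᶜ).ncard := by
    refine (Set.ncard_le_ncard (compl_fixedBy_commutator_subset a d)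
      (Set.toFinite _)).trans ?_
    refine (Set.ncard_union_le _ _).trans ?_
    have h1 := Set.ncard_union_le
      ((fun x => a • x) '' ((MulAction.fixedBy Ω a)ᶜ ∩ (MulAction.fixedBy Ω d)ᶜ))
      ((fun x => d • x) '' ((MulAction.fixedBy Ω a)ᶜ ∩ (MulAction.fixedBy Ω d)ᶜ))
    rw [Set.ncard_image_of_injective _ (MulAction.injective a),
      Set.ncard_image_of_injective _ (MulAction.injective d)] at h1
    omega
  have hm := hmin _ hc
  rw [← hI, ← Set.ncard_eq_toFinset_card', ← Set.ncard_eq_toFinset_card', hbcard,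
    ← Nat.card_eq_fintype_card] at hh
  have hp : 0 < (MulAction.fixedBy Ω a)ᶜ.ncard := by
    rw [Set.ncard_pos, Set.nonempty_compl]
    intro h1
    have : a = 1 := eq_of_smul_eq_smul fun x : Ω => by
      rw [one_smul, ← MulAction.mem_fixedBy, h1]
      trivial
    exact ha (by rw [this, map_one])
  refine Nat.le_of_mul_le_mul_right ?_ hp
  -- With `s` the support size of `a` and `I` the common support: `n s ≤ 3 n |I| ≤ 3 s²`.
  nlinarith [Nat.mul_le_mul_left (Nat.card Ω) (hm.trans hcI)]

theorem Nat.card_filter_dvd_le_log {P : Finset ℕ} (hP : ∀ p ∈ P, p.Prime) {m n : ℕ} (hm : 0 < m)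
    (hmn : m ≤ n) : (P.filter (· ∣ m)).card ≤ Nat.log 2 n := by
  refine Nat.le_log_of_pow_le one_lt_two (le_trans ?_ hmn)
  refine le_trans ?_ (Nat.le_of_dvd hm (Finset.prod_primes_dvd (s := P.filter (· ∣ m)) m
    (fun p hp => (hP p (Finset.mem_filter.1 hp).1).prime) fun p hp => (Finset.mem_filter.1 hp).2))
  exact Finset.pow_card_le_prod _ _ _ fun p hp => (hP p (Finset.mem_filter.1 hp).1).two_le

/-- Some power of `g` lies outside the kernel and moves only points whose `g`-orbit has length
divisible by `p`. -/
theorem MulAction.exists_pow_map_ne_one_of_dvd_orderOf {G S Ω : Type*} [Group G] [Finite G]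
    [MulAction G Ω] [Group S] (φ : G →* S) (g : G) {p : ℕ} (hp : p.Prime)
    (hpg : p ∣ orderOf (φ g)) : ∃ m : ℕ, φ (g ^ m) ≠ 1 ∧
      ∀ x : Ω, ¬ p ∣ Function.minimalPeriod (g • ·) x → g ^ m • x = x := by
  -- The exponent is the `p'`-part of the order of `g`.
  have h0 : orderOf g ≠ 0 := (orderOf_pos g).ne'
  refine ⟨ordCompl[p] (orderOf g), fun h => ?_, fun x hx => ?_⟩
  · rw [map_pow, ← orderOf_dvd_iff_pow_eq_one] at h
    exact Nat.not_dvd_ordCompl hp h0 (hpg.trans h)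
  · rw [MulAction.pow_smul_eq_iff_minimalPeriod_dvd]
    have h1 : Function.minimalPeriod (g • ·) x ∣ orderOf g := by
      rw [← MulAction.pow_smul_eq_iff_minimalPeriod_dvd, pow_orderOf_eq_one, one_smul]
    rw [← Nat.ordProj_mul_ordCompl_eq_self (orderOf g) p] at h1
    exact (((Nat.Prime.coprime_iff_not_dvd hp).2 hx).symm.pow_right _).dvd_of_dvd_mul_left h1

theorem MulAction.card_primes_dvd_orderOf_map_le {G S Ω : Type*} [Group G] [Finite G]
    [MulAction G Ω] [Finite Ω] [Nonempty Ω] [Group S] [IsSimpleGroup S]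
    (hS : Subgroup.center S = ⊥)
    (φ : G →* S) (hφ : Function.Surjective φ) [MulAction.IsPretransitive φ.ker Ω]
    [FaithfulSMul G Ω] (g : G) {P : Finset ℕ} (hP : ∀ p ∈ P, p.Prime)
    (hPg : ∀ p ∈ P, p ∣ orderOf (φ g)) : P.card ≤ 3 * Nat.log 2 (Nat.card Ω) := by
  classical
  have := Fintype.ofFinite Ω
  have hle : ∀ p ∈ P, Nat.card Ω ≤
      3 * (Finset.univ.filter fun x : Ω => p ∣ Function.minimalPeriod (g • ·) x).card := by
    intro p hp
    obtain ⟨m, hm1, hm2⟩ := exists_pow_map_ne_one_of_dvd_orderOf (Ω := Ω) φ g (hP p hp) (hPg p hp)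
    refine (card_le_three_mul_card_moved_of_map_ne_one hS φ hφ hm1).trans
      (Nat.mul_le_mul_left 3 ?_)
    rw [← Set.ncard_coe_finset]
    refine Set.ncard_le_ncard (fun x hx => ?_) (Set.toFinite _)
    by_contra h
    exact hx (hm2 x (by simpa using h))
  -- Double count pairs of a prime and a point whose cycle length it divides.
  have hsum : P.card * Nat.card Ω ≤
      3 * ∑ x : Ω, (P.filter (· ∣ Function.minimalPeriod (g • ·) x)).card := by
    calc P.card * Nat.card Ω = ∑ _p ∈ P, Nat.card Ω := by simp
      _ ≤ _ := Finset.sum_le_sum hle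
      _ = _ := by
        rw [← Finset.mul_sum]
        simp only [Finset.card_filter]
        rw [Finset.sum_comm]
  have hlog : ∑ x : Ω, (P.filter (· ∣ Function.minimalPeriod (g • ·) x)).card ≤
      Nat.card Ω * Nat.log 2 (Nat.card Ω) := by
    calc _ ≤ ∑ _x : Ω, Nat.log 2 (Nat.card Ω) := Finset.sum_le_sum fun x _ =>
          Nat.card_filter_dvd_le_log hP
            (Function.minimalPeriod_pos_of_mem_periodicPts
              ((MulAction.injective g).mem_periodicPts x))
            (Nat.card_eq_fintype_card (α := Ω) ▸ Function.minimalPeriod_le_card)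
      _ = _ := by
        rw [Finset.sum_const, Finset.card_univ, Nat.card_eq_fintype_card, smul_eq_mul]
  refine Nat.le_of_mul_le_mul_right ?_ (Nat.card_pos (α := Ω))
  nlinarith

/-- Take disjoint `p`-cycles; odd lengths make the product even. -/
theorem alternatingGroup.exists_orderOf_dvd {α : Type*} [Fintype α] [DecidableEq α]
    {P : Finset ℕ} (hP : ∀ p ∈ P, p.Prime) (hodd : ∀ p ∈ P, Odd p)
    (hsum : ∑ p ∈ P, p ≤ Fintype.card α) :
    ∃ y : alternatingGroup α, ∀ p ∈ P, p ∣ orderOf y := by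
  obtain ⟨σ, hσ⟩ := (Equiv.Perm.exists_with_cycleType_iff α (m := P.val)).2
    ⟨by rwa [Finset.sum_val], fun a ha => (hP a ha).two_le⟩
  refine ⟨⟨σ, ?_⟩, fun p hp => ?_⟩
  · rw [Equiv.Perm.mem_alternatingGroup, Equiv.Perm.sign_of_cycleType', hσ]
    refine Multiset.prod_eq_one fun x hx => ?_
    obtain ⟨p, hp, rfl⟩ := Multiset.mem_map.1 hx
    simp [(hodd p hp).neg_one_pow]
  · rw [Subgroup.orderOf_mk, ← Equiv.Perm.lcm_cycleType, hσ]
    exact Multiset.dvd_lcm hp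

theorem Nat.cube_add_one_le_two_pow {L : ℕ} (hL : 10 ≤ L) : L ^ 3 + 1 ≤ 2 ^ L := by
  induction L, hL using Nat.le_induction with
  | base => norm_num
  | succ n hn ih =>
    rw [pow_succ 2]
    nlinarith [mul_le_mul hn hn (by norm_num) (by omega), Nat.mul_le_mul_left (n ^ 2) hn]

/-- Chebyshev's bounds on `ψ`, with `log (L ^ 3) ≤ L log 2`, give `π(L ^ 3) ≥ L ^ 2 - 1`. -/
theorem Nat.three_mul_add_two_le_primeCounting_cube {L : ℕ} (hL : 10 ≤ L) :
    3 * L + 2 ≤ Nat.primeCounting (L ^ 3) := by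
  have h2 : (0 : ℝ) < Real.log 2 := Real.log_pos one_lt_two
  have hL' : (10 : ℝ) ≤ L := by exact_mod_cast hL
  have h1 : Real.log ((L ^ 3 : ℕ) + 1) ≤ L * Real.log 2 := by
    rw [← Real.log_pow]
    refine Real.log_le_log (by positivity) ?_
    exact_mod_cast Nat.cube_add_one_le_two_pow hL
  have hlog : Real.log (L ^ 3 : ℕ) ≤ L * Real.log 2 :=
    le_trans (Real.log_le_log (by positivity) (by linarith)) h1
  have h3 := (Chebyshev.psi_ge (L ^ 3)).trans (Chebyshev.psi_le_primeCounting_mul_log (L ^ 3))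
  have h4 : ((L : ℝ) ^ 3 - L) * Real.log 2 ≤
      (Nat.primeCounting (L ^ 3) * L) * Real.log 2 := by
    have := mul_le_mul_of_nonneg_left hlog (Nat.cast_nonneg (Nat.primeCounting (L ^ 3)) (α := ℝ))
    push_cast at *
    linarith
  have h5 := le_of_mul_le_mul_right h4 h2
  have h6 : (L : ℝ) ^ 2 - 1 ≤ Nat.primeCounting (L ^ 3) := by
    refine le_of_mul_le_mul_right ?_ (show (0 : ℝ) < L by linarith)
    linarith
  have h7 : ((3 * L + 2 : ℕ) : ℝ) ≤ Nat.primeCounting (L ^ 3) := by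
    push_cast
    nlinarith
  exact_mod_cast h7

theorem Nat.exists_odd_primes_sum_le {L : ℕ} (hL : 10 ≤ L) : ∃ P : Finset ℕ,
    P.card = 3 * L + 1 ∧ (∀ p ∈ P, p.Prime) ∧ (∀ p ∈ P, Odd p) ∧ ∑ p ∈ P, p ≤ L ^ 5 := by
  have h1 : 3 * L + 1 ≤ ((Nat.primesLE (L ^ 3)).erase 2).card := by
    have := Nat.three_mul_add_two_le_primeCounting_cube hL
    rw [← Nat.primesLE_card_eq_primeCounting] at this
    have := Finset.pred_card_le_card_erase (s := Nat.primesLE (L ^ 3)) (a := 2)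
    omega
  obtain ⟨P, hP, hcard⟩ := Finset.exists_subset_card_eq h1
  have hmem : ∀ p ∈ P, p ≠ 2 ∧ p ≤ L ^ 3 ∧ p.Prime := fun p hp => by
    simpa [Nat.mem_primesLE] using hP hp
  refine ⟨P, hcard, fun p hp => (hmem p hp).2.2,
    fun p hp => (hmem p hp).2.2.odd_of_ne_two (hmem p hp).1, ?_⟩
  refine (Finset.sum_le_card_nsmul _ _ _ fun p hp => (hmem p hp).2.1).trans ?_
  rw [hcard, smul_eq_mul, show L ^ 5 = L ^ 2 * L ^ 3 by ring]
  -- `3 * L + 1 ≤ L ^ 2` primes of size at most `L ^ 3`: hence the exponent 5.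
  exact Nat.mul_le_mul_right _ (by nlinarith)

theorem mainTheorem2 :
    ∃ k₀ : ℕ, ∀ (k : ℕ), k₀ ≤ k →
      ∀ (n : ℕ) (Ω : Type*) [Finite Ω], Nat.card Ω = n →
      ∀ (G : Subgroup (Equiv.Perm Ω)), MulAction.IsPreprimitive G Ω →
      ∀ (φ : G →* alternatingGroup (Fin k)), Function.Surjective φ →
      (Real.logb 2 (n : ℝ)) ^ 5 < (k : ℝ) →
      Function.Bijective φ ∧ Nonempty (G ≃* alternatingGroup (Fin k)) := by
  -- This `k₀` covers small `n`, where `L` is replaced by 10.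
  refine ⟨10 ^ 5, fun k hk n Ω _ hn G hG φ hφ hlog => ?_⟩
  suffices hinj : Function.Injective φ from
    ⟨⟨hinj, hφ⟩, ⟨MulEquiv.ofBijective φ ⟨hinj, hφ⟩⟩⟩
  by_contra hinj
  subst hn
  have hker : φ.ker ≠ ⊥ := fun h => hinj ((MonoidHom.ker_eq_bot_iff φ).1 h)
  obtain ⟨g, hg, hg1⟩ := φ.ker.bot_or_exists_ne_one.resolve_left hker
  obtain ⟨x, hx⟩ : ∃ x : Ω, g • x ≠ x := by
    by_contra! h
    exact hg1 (eq_of_smul_eq_smul fun x : Ω => by rw [h x, one_smul])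
  have : Nonempty Ω := ⟨x⟩
  have : MulAction.IsPretransitive φ.ker Ω :=
    MulAction.IsQuasiPreprimitive.isPretransitive_of_normal (G := G) fun h =>
      hx ((h ▸ Set.mem_univ x : x ∈ MulAction.fixedPoints φ.ker Ω) ⟨g, hg⟩)
  have : IsSimpleGroup (alternatingGroup (Fin k)) :=
    alternatingGroup.isSimpleGroup (by rw [Nat.card_fin]; omega)
  have hcenter : Subgroup.center (alternatingGroup (Fin k)) = ⊥ :=
    alternatingGroup.center_eq_bot (by rw [Nat.card_fin]; omega)
  set L := Nat.log 2 (Nat.card Ω)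
  obtain ⟨P, hcard, hP, hodd, hsum⟩ := Nat.exists_odd_primes_sum_le (le_max_right L 10)
  have hLk : (max L 10) ^ 5 ≤ k := by
    rcases max_cases L 10 with ⟨h, -⟩ | ⟨h, -⟩ <;> rw [h]
    · have h1 : (L : ℝ) ≤ Real.logb 2 (Nat.card Ω) := Real.natLog_le_logb _ _
      have h2 : (L : ℝ) ^ 5 < k := (pow_le_pow_left₀ (Nat.cast_nonneg L) h1 5).trans_lt hlog
      exact_mod_cast h2.le
    · exact hk
  obtain ⟨y, hy⟩ := alternatingGroup.exists_orderOf_dvd (α := Fin k) hP hodd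
    (by rw [Fintype.card_fin]; exact hsum.trans hLk)
  obtain ⟨a, rfl⟩ := hφ y
  have := MulAction.card_primes_dvd_orderOf_map_le (Ω := Ω) hcenter φ hφ a hP hy
  have := le_max_left L 10
  omega
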